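/- Let $d\ge 1$ and $\mathbb I=[0,1]$. A $d$-variate quasi-copula is a function $Q\colon\mathbb I^d\to\mathbb I$ with $Q(1,\dots,1,u_j,1,\dots,1)=u_j$ for every $j$ that is increasing and $1$-Lipschitz in each of its variables. A straight shuffle of min is a function $C\colon\mathbb I^d\to\mathbb I$ of the form $$C(u_1,\dots,u_d)=\lambda\bigl(\{t\in(0,1] : \varphi_k(t)\in(0,u_k]\text{ for }k=1,\dots,d\}\bigr),$$ where $\lambda$ is the Lebesgue measure and, for every $k$, the map $\varphi_k\colon(0,1]\to(0,1]$ cuts $(0,1]$ into finitely many half-open intervals $(a_{i-1},a_i]$ and rearranges them by translations according to a permutation (the number of intervals, the cuts and the permutation may depend on $k$). Thus the mass of $M(\mathbf u)=\min_k u_k$, uniformly distributed on the main diagonal of the cube, is moved by $(t,\dots,t)\mapsto(\varphi_1(t),\dots,\varphi_d(t))$. A straight shuffle of min is called $3$-slice if the maps $\varphi_k$ can be chosen so that for some cuts $0=c_0^k<c_1^k<c_2^k<c_3^k=1$ $(k=1,\dots,d)$ the following holds: for each of the $3^d$ boxes $R_{\mathbf i}=\prod_{k}(c^k_{i_k-1},c^k_{i_k}]$,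 $\mathbf i\in\{1,2,3\}^d$, the set of all $t\in(0,1]$ with $(\varphi_1(t),\dots,\varphi_d(t))\in R_{\mathbf i}$ is a (possibly empty) half-open interval on which each $\varphi_k$ is a translation; that is, in each of the $3^d$ boxes the mass of the shuffle is one translated segment of the main diagonal. Theorem. Every $d$-variate quasi-copula is a pointwise supremum of a set of pointwise infima of sets of straight shuffles of min, and it is also a pointwise infimum of a set of pointwise suprema of sets of straight shuffles of min (all sets being nonempty). Both representations exist even with $3$-slice shuffles of min only. -/

import Mathlib

open MeasureTheory

/-- A `d`-variate quasi-copula: a function `A : [0,1]^d → [0,1]` with uniform margins that is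
increasing and `1`-Lipschitz in each of its variables. -/
structure IsQuasiCopula {d : ℕ} (A : (Fin d → unitInterval) → unitInterval) : Prop where
  margin : ∀ (j : Fin d) (t : unitInterval), A (Function.update (fun _ => 1) j t) = t
  increasing : ∀ (j : Fin d) (u : Fin d → unitInterval) (s t : unitInterval), s ≤ t →
    A (Function.update u j s) ≤ A (Function.update u j t)
  lipschitz : ∀ (j : Fin d) (u : Fin d → unitInterval) (s t : unitInterval),
    |(A (Function.update u j s) : ℝ) - (A (Function.update u j t) : ℝ)| ≤ |(s : ℝ) - (t : ℝ)|

/-- A slicing of `(0,1]` into finitely many half-open intervals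
`(cut 0, cut 1], …, (cut (n-1), cut n]` together with a permutation that tells in which order the
slices are put back together: slice `i` becomes slice number `perm i`. -/
structure Slicing where
  n : ℕ
  cut : Fin (n + 1) → ℝ
  cut_mono : Monotone cut
  cut_zero : cut 0 = 0
  cut_last : cut (Fin.last n) = 1
  perm : Equiv.Perm (Fin n)

/-- The length of the slice with index `i`. -/
def Slicing.length (σ : Slicing) (i : Fin σ.n) : ℝ :=
  σ.cut i.succ - σ.cut i.castSucc

open Classical in
/-- The piecewise translation of `(0,1]` that rearranges the slices. A point `t` of the slice `i` is
sent to `t - cut i + ∑ {length j | perm j < perm i}`: no slice is flipped. -/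
noncomputable def Slicing.map (σ : Slicing) (t : ℝ) : ℝ :=
  ∑ i : Fin σ.n,
    if t ∈ Set.Ioc (σ.cut i.castSucc) (σ.cut i.succ) then
      t - σ.cut i.castSucc + ∑ j : Fin σ.n, if σ.perm j < σ.perm i then σ.length j else 0
    else 0

/-- `C` is the straight shuffle of min given by one slicing `σ k` for each coordinate `k`.
The mass of the copula `M = min` is uniformly distributed on the main diagonal, so it is carried by
the points `(t, …, t)` with `t` distributed according to the Lebesgue measure on `(0,1]`. The shuffle
moves the mass at `(t, …, t)` to `((σ 0).map t, (σ 1).map t, …)`, and `C u` is the resulting mass of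
the box `(0, u 0] × (0, u 1] × …`. -/
def IsShuffleOfMinBy {d : ℕ} (σ : Fin d → Slicing)
    (C : (Fin d → unitInterval) → unitInterval) : Prop :=
  ∀ u : Fin d → unitInterval,
    (C u : ℝ) =
      (volume {t : ℝ | t ∈ Set.Ioc 0 1 ∧ ∀ k, (σ k).map t ∈ Set.Ioc 0 (u k : ℝ)}).toReal

/-- Straight shuffles of min (numbers of slices and permutations may differ between coordinates). -/
def IsStraightShuffleOfMin {d : ℕ} (C : (Fin d → unitInterval) → unitInterval) : Prop :=
  ∃ σ : Fin d → Slicing, IsShuffleOfMinBy σ C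

/-- `m`-slice (straight) shuffles of min: the cube can be split into `m` slices in each of the
coordinates, hence into `m ^ d` boxes, in such a way that in each of these boxes the mass of the
shuffle is one (possibly empty) translated segment of the main diagonal, i.e. the part
`p < t ≤ r` of the main diagonal, moved by the vector `v`. -/
def IsSliceShuffleOfMin {d : ℕ} (m : ℕ) (C : (Fin d → unitInterval) → unitInterval) : Prop :=
  ∃ σ : Fin d → Slicing, IsShuffleOfMinBy σ C ∧
    ∃ c : Fin d → Fin (m + 1) → ℝ,
      (∀ k, StrictMono (c k) ∧ c k 0 = 0 ∧ c k (Fin.last m) = 1) ∧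
      ∀ i : Fin d → Fin m, ∃ (p r : ℝ) (v : Fin d → ℝ),
        {t : ℝ | t ∈ Set.Ioc 0 1 ∧
          ∀ k, (σ k).map t ∈ Set.Ioc (c k (i k).castSucc) (c k (i k).succ)} = Set.Ioc p r ∧
        ∀ t ∈ Set.Ioc p r, ∀ k, (σ k).map t = t + v k

/-- `g` is the pointwise supremum of the nonempty set `F` of functions. -/
def IsPointwiseSup {d : ℕ} (F : Set ((Fin d → unitInterval) → unitInterval))
    (g : (Fin d → unitInterval) → unitInterval) : Prop :=
  F.Nonempty ∧ ∀ u, IsLUB ((fun f => f u) '' F) (g u)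

/-- `g` is the pointwise infimum of the nonempty set `F` of functions. -/
def IsPointwiseInf {d : ℕ} (F : Set ((Fin d → unitInterval) → unitInterval))
    (g : (Fin d → unitInterval) → unitInterval) : Prop :=
  F.Nonempty ∧ ∀ u, IsGLB ((fun f => f u) '' F) (g u)

/-- `Q` is a pointwise supremum of a set of pointwise infima of subsets of `D`. -/
def IsSupOfInfs {d : ℕ} (D : Set ((Fin d → unitInterval) → unitInterval))
    (Q : (Fin d → unitInterval) → unitInterval) : Prop :=
  ∃ G : Set ((Fin d → unitInterval) → unitInterval),
    (∀ g ∈ G, ∃ F ⊆ D, IsPointwiseInf F g) ∧ IsPointwiseSup G Q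

/-- `Q` is a pointwise infimum of a set of pointwise suprema of subsets of `D`. -/
def IsInfOfSups {d : ℕ} (D : Set ((Fin d → unitInterval) → unitInterval))
    (Q : (Fin d → unitInterval) → unitInterval) : Prop :=
  ∃ G : Set ((Fin d → unitInterval) → unitInterval),
    (∀ g ∈ G, ∃ F ⊆ D, IsPointwiseSup F g) ∧ IsPointwiseInf G Q

/-! Everything reduces to two points: for all `a`, `b` there is a 3-slice shuffle `C` with `Q a ≤ C
a` and `C b ≤ Q b` (`IsQuasiCopula.exists_sliceShuffle`). With such a `C a b` chosen for each pair,
the infimum over `b` lies below `Q` everywhere and is at least `Q a` at `a`, so the supremum over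
`a` of these infima is `Q`; the other representation is dual.

To build `C`, each coordinate `k` labels the points of `(0,1]` by 0, 1, 2 and sorts them stably by
label. A point then moves to the mass of the points that precede it. Hence `C a ≥ α` if, for `t ≤
α`, the labels up to that of `t` have mass at most `a k` in every coordinate (`le_shuffle`), and `C
b ≤ β` if every `t > β` has, in some coordinate, mass at least `b k` of smaller labels
(`shuffle_le`).

Put `α = Q a`, `β = Q b`. Label 2 is given to intervals that cover `(max α β, 1]`; if `β < α`, label
1 is given to disjoint intervals that cover `(β, α]`. There is enough length for this because `1 - β
≤ ∑ (1 - b k)` and `α - β ≤ ∑ max (a k - b k) 0`, both consequences of the Lipschitz condition. The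
intervals are arranged so that the points with the same labels in all coordinates form an interval;
this gives the 3-slice property (`isSliceShuffleOfMin_shuffle`). -/

lemma Slicing.map_of_mem (σ : Slicing) {i : Fin σ.n} {t : ℝ}
    (ht : t ∈ Set.Ioc (σ.cut i.castSucc) (σ.cut i.succ)) :
    σ.map t = t - σ.cut i.castSucc +
      ∑ j : Fin σ.n, if σ.perm j < σ.perm i then σ.length j else 0 := by
  classical
  unfold Slicing.map
  rw [Finset.sum_eq_single i]
  · rw [if_pos ht]
  · intro j _ hj
    refine if_neg fun hjt => ?_
    rcases lt_or_gt_of_ne hj with h | h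
    · have : σ.cut j.succ ≤ σ.cut i.castSucc := σ.cut_mono (by
        rw [Fin.le_def]; simpa using h)
      exact absurd (hjt.2.trans this) (not_le.2 ht.1)
    · have : σ.cut i.succ ≤ σ.cut j.castSucc := σ.cut_mono (by
        rw [Fin.le_def]; simpa using h)
      exact absurd (ht.2.trans this) (not_le.2 hjt.1)
  · simp

/-! ### Rearranging slices in the order of their labels. -/

/-- The permutation that sorts the indices by their labels and keeps the order of the indices with
equal labels. -/
noncomputable def stablePerm {n m : ℕ} (g : Fin n → Fin m) : Equiv.Perm (Fin n) :=
  (Tuple.sort fun i => toLex (g i, i)).symm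

/-- The pairs (label, index) are distinct, so sorting them lexicographically is strictly monotone
and ties between labels are broken by index. -/
lemma stablePerm_lt_iff {n m : ℕ} (g : Fin n → Fin m) (i j : Fin n) :
    stablePerm g j < stablePerm g i ↔ g j < g i ∨ g j = g i ∧ j < i := by
  set f : Fin n → Fin m ×ₗ Fin n := fun i => toLex (g i, i) with hf
  have hinj : Function.Injective f := fun x y h => by
    have := congrArg (fun z => (ofLex z).2) h
    simpa [hf] using this
  have hmono : StrictMono (f ∘ Tuple.sort f) :=
    (Tuple.monotone_sort f).strictMono_of_injective (hinj.comp (Tuple.sort f).injective)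
  have h := hmono.lt_iff_lt (a := (Tuple.sort f).symm j) (b := (Tuple.sort f).symm i)
  simp only [Function.comp_apply, Equiv.apply_symm_apply] at h
  unfold stablePerm
  exact h.symm.trans Prod.Lex.toLex_lt_toLex

/-- A strictly increasing subdivision of `[0,1]` into `n` intervals. -/
structure Subdivision (n : ℕ) where
  cut : Fin (n + 1) → ℝ
  strictMono : StrictMono cut
  cut_zero : cut 0 = 0
  cut_last : cut (Fin.last n) = 1

namespace Subdivision

variable {n : ℕ} (S : Subdivision n)

/-- The half-open interval with index `i`. -/
def slice (i : Fin n) : Set ℝ := Set.Ioc (S.cut i.castSucc) (S.cut i.succ)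

lemma lt_of_mem_of_mem {i j : Fin n} (h : j < i) {x t : ℝ} (hx : x ∈ S.slice j)
    (ht : t ∈ S.slice i) : x < t := by
  have : S.cut j.succ ≤ S.cut i.castSucc := S.strictMono.monotone (by
    rw [Fin.le_def]; simpa using h)
  exact (hx.2.trans this).trans_lt ht.1

lemma slice_disjoint : Pairwise (Function.onFun Disjoint S.slice) := by
  intro i j hij
  refine Set.disjoint_left.2 fun x hi hj => ?_
  rcases lt_or_gt_of_ne hij with h | h
  · exact lt_irrefl _ (S.lt_of_mem_of_mem h hi hj)
  · exact lt_irrefl _ (S.lt_of_mem_of_mem h hj hi)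

lemma cut_nonneg (i : Fin (n + 1)) : 0 ≤ S.cut i :=
  S.cut_zero ▸ S.strictMono.monotone (Fin.zero_le i)

lemma cut_le_one (i : Fin (n + 1)) : S.cut i ≤ 1 :=
  S.cut_last ▸ S.strictMono.monotone (Fin.le_last i)

lemma slice_subset (i : Fin n) : S.slice i ⊆ Set.Ioc 0 1 :=
  Set.Ioc_subset_Ioc (S.cut_nonneg _) (S.cut_le_one _)

lemma cut_succ_mem (i : Fin n) : S.cut i.succ ∈ S.slice i :=
  ⟨S.strictMono Fin.castSucc_lt_succ, le_rfl⟩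

lemma exists_mem_slice {t : ℝ} (ht : t ∈ Set.Ioc (0 : ℝ) 1) : ∃ i, t ∈ S.slice i := by
  have key : ∀ k : Fin (n + 1), t ≤ S.cut k → ∃ i, t ∈ S.slice i := by
    intro k
    induction k using Fin.induction with
    | zero => intro h; exact absurd (S.cut_zero ▸ h) (not_le.2 ht.1)
    | succ i ih =>
      intro h
      by_cases h' : t ≤ S.cut i.castSucc
      · exact ih h'
      · exact ⟨i, not_le.1 h', h⟩
  exact key (Fin.last n) (S.cut_last ▸ ht.2)

/-- The slicing that sorts the slices of a subdivision by their labels. -/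
noncomputable def slicing {m : ℕ} (g : Fin n → Fin m) : Slicing where
  n := n
  cut := S.cut
  cut_mono := S.strictMono.monotone
  cut_zero := S.cut_zero
  cut_last := S.cut_last
  perm := stablePerm g

/-- The label function `lab` is constant on the slices. -/
def Adapted {m : ℕ} (lab : ℝ → Fin m) : Prop :=
  ∀ i, ∀ x ∈ S.slice i, lab x = lab (S.cut i.succ)

/-- The slicing that sorts the slices by the value of a label function. -/
noncomputable def labelSlicing {m : ℕ} (lab : ℝ → Fin m) : Slicing :=
  S.slicing fun i => lab (S.cut i.succ)

lemma measurableSet_slice (i : Fin n) : MeasurableSet (S.slice i) := measurableSet_Ioc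

lemma volume_biUnion_slice (J : Finset (Fin n)) :
    volume.real (⋃ j ∈ J, S.slice j) = ∑ j ∈ J, (S.cut j.succ - S.cut j.castSucc) := by
  rw [measureReal_biUnion_finset (fun i _ j _ h => S.slice_disjoint h)
    (fun i _ => S.measurableSet_slice i) (fun i _ => by simp [slice])]
  refine Finset.sum_congr rfl fun j _ => ?_
  rw [slice, Real.volume_real_Ioc_of_le (S.strictMono Fin.castSucc_lt_succ).le]

/-- A point is moved to the total mass of the points which precede it in the order by labels. -/
lemma labelSlicing_map {m : ℕ} {lab : ℝ → Fin m} (hlab : S.Adapted lab) {t : ℝ}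
    (ht : t ∈ Set.Ioc (0 : ℝ) 1) :
    (S.labelSlicing lab).map t =
      volume.real {x ∈ Set.Ioc (0 : ℝ) 1 | lab x < lab t ∨ lab x = lab t ∧ x ≤ t} := by
  classical
  obtain ⟨i, hi⟩ := S.exists_mem_slice ht
  -- The points that precede `t` fill the slices placed before the slice of `t`, and the part of
  -- that slice up to `t`.
  set J : Finset (Fin n) := Finset.univ.filter fun j =>
    lab (S.cut j.succ) < lab (S.cut i.succ) ∨
      lab (S.cut j.succ) = lab (S.cut i.succ) ∧ j < i with hJ
  have hset : {x ∈ Set.Ioc (0 : ℝ) 1 | lab x < lab t ∨ lab x = lab t ∧ x ≤ t} =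
      (⋃ j ∈ J, S.slice j) ∪ Set.Ioc (S.cut i.castSucc) t := by
    ext x
    simp only [Set.mem_ofPred_eq, Set.mem_union, Set.mem_iUnion, hJ, Finset.mem_filter,
      Finset.mem_univ, true_and, exists_prop, hlab i t hi]
    constructor
    · rintro ⟨hx, h⟩
      obtain ⟨j, hj⟩ := S.exists_mem_slice hx
      rw [hlab j x hj] at h
      rcases h with h | ⟨h, hxt⟩
      · exact Or.inl ⟨j, Or.inl h, hj⟩
      · rcases lt_trichotomy j i with hji | rfl | hji
        · exact Or.inl ⟨j, Or.inr ⟨h, hji⟩, hj⟩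
        · exact Or.inr ⟨hj.1, hxt⟩
        · exact absurd (S.lt_of_mem_of_mem hji hi hj) (not_lt.2 hxt)
    · rintro (⟨j, h, hj⟩ | hx)
      · refine ⟨S.slice_subset j hj, ?_⟩
        rw [hlab j x hj]
        rcases h with h | ⟨h, hji⟩
        · exact Or.inl h
        · exact Or.inr ⟨h, (S.lt_of_mem_of_mem hji hj hi).le⟩
      · have hxi : x ∈ S.slice i := ⟨hx.1, hx.2.trans hi.2⟩
        exact ⟨S.slice_subset i hxi, Or.inr ⟨hlab i x hxi, hx.2⟩⟩
  have hdisj : Disjoint (⋃ j ∈ J, S.slice j) (Set.Ioc (S.cut i.castSucc) t) := by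
    refine Set.disjoint_left.2 fun x hx hxt => ?_
    simp only [Set.mem_iUnion, exists_prop] at hx
    obtain ⟨j, hj, hxj⟩ := hx
    have hxi : x ∈ S.slice i := ⟨hxt.1, hxt.2.trans hi.2⟩
    have hne : j ≠ i := by rintro rfl; simp [hJ] at hj
    exact Set.disjoint_left.1 (S.slice_disjoint hne) hxj hxi
  rw [Slicing.map_of_mem (S.labelSlicing lab) (i := i) hi, hset,
    measureReal_union hdisj measurableSet_Ioc
      (measure_ne_top_of_subset (Set.iUnion₂_subset fun j _ => S.slice_subset j) (by simp))
      (by simp),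
    volume_biUnion_slice, Real.volume_real_Ioc_of_le hi.1.le, add_comm, hJ, Finset.sum_filter]
  congr 1
  refine Finset.sum_congr rfl fun j _ => ?_
  have := stablePerm_lt_iff (fun i => lab (S.cut i.succ)) i j
  by_cases h : stablePerm (fun i => lab (S.cut i.succ)) j <
      stablePerm (fun i => lab (S.cut i.succ)) i
  · rw [if_pos (this.1 h)]; exact if_pos h
  · rw [if_neg (mt this.2 h)]; exact if_neg h

end Subdivision

/-! ### Position estimates and the shuffle given by label functions. -/

namespace Subdivision

variable {n : ℕ} (S : Subdivision n)

lemma volume_ne_top_of_subset_Ioc {A : Set ℝ} (h : A ⊆ Set.Ioc (0 : ℝ) 1) : volume A ≠ ⊤ :=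
  measure_ne_top_of_subset h (by simp)

lemma labelSlicing_map_le {m : ℕ} {lab : ℝ → Fin m} (hlab : S.Adapted lab) {t : ℝ}
    (ht : t ∈ Set.Ioc (0 : ℝ) 1) {P : Fin m → Prop} (hP : ∀ l ≤ lab t, P l) :
    (S.labelSlicing lab).map t ≤ volume.real {x ∈ Set.Ioc (0 : ℝ) 1 | P (lab x)} := by
  rw [S.labelSlicing_map hlab ht]
  refine measureReal_mono (fun x hx => ⟨hx.1, hP _ ?_⟩)
    (volume_ne_top_of_subset_Ioc fun x hx => hx.1)
  rcases hx.2 with h | h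
  · exact h.le
  · exact h.1.le

/-- The inequality is strict because the part of the slice of `t` up to `t` also precedes `t` and
has positive length. -/
lemma lt_labelSlicing_map {m : ℕ} {lab : ℝ → Fin m} (hlab : S.Adapted lab) {t : ℝ}
    (ht : t ∈ Set.Ioc (0 : ℝ) 1) {P : Fin m → Prop} (hP : ∀ l, P l → l < lab t) :
    volume.real {x ∈ Set.Ioc (0 : ℝ) 1 | P (lab x)} < (S.labelSlicing lab).map t := by
  obtain ⟨i, hi⟩ := S.exists_mem_slice ht
  have hI : ∀ x ∈ Set.Ioc (S.cut i.castSucc) t, x ∈ S.slice i := fun x hx =>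
    ⟨hx.1, hx.2.trans hi.2⟩
  have hdisj : Disjoint {x ∈ Set.Ioc (0 : ℝ) 1 | P (lab x)} (Set.Ioc (S.cut i.castSucc) t) := by
    refine Set.disjoint_left.2 fun x hx hxt => ?_
    have h := hP _ hx.2
    rw [hlab i x (hI x hxt), hlab i t hi] at h
    exact lt_irrefl _ h
  rw [S.labelSlicing_map hlab ht]
  calc volume.real {x ∈ Set.Ioc (0 : ℝ) 1 | P (lab x)}
      < volume.real {x ∈ Set.Ioc (0 : ℝ) 1 | P (lab x)} + (t - S.cut i.castSucc) :=
        lt_add_of_pos_right _ (sub_pos.2 hi.1)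
    _ = volume.real ({x ∈ Set.Ioc (0 : ℝ) 1 | P (lab x)} ∪ Set.Ioc (S.cut i.castSucc) t) := by
        rw [measureReal_union hdisj measurableSet_Ioc
          (volume_ne_top_of_subset_Ioc fun x hx => hx.1) (by simp),
          Real.volume_real_Ioc_of_le hi.1.le]
    _ ≤ _ := by
        refine measureReal_mono ?_ (volume_ne_top_of_subset_Ioc fun x hx => hx.1)
        rintro x (hx | hx)
        · exact ⟨hx.1, Or.inl (hP _ hx.2)⟩
        · refine ⟨S.slice_subset i (hI x hx), Or.inr ⟨?_, hx.2⟩⟩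
          rw [hlab i x (hI x hx), hlab i t hi]

lemma labelSlicing_map_pos {m : ℕ} {lab : ℝ → Fin m} (hlab : S.Adapted lab) {t : ℝ}
    (ht : t ∈ Set.Ioc (0 : ℝ) 1) : 0 < (S.labelSlicing lab).map t := by
  simpa using S.lt_labelSlicing_map hlab ht (P := fun _ => False) (by simp)

/-- On an interval with constant label the points are moved by a translation. -/
lemma labelSlicing_map_sub {m : ℕ} {lab : ℝ → Fin m} (hlab : S.Adapted lab) {s t : ℝ}
    (hs : s ∈ Set.Ioc (0 : ℝ) 1) (ht : t ∈ Set.Ioc (0 : ℝ) 1) (hst : s ≤ t)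
    (h : ∀ x ∈ Set.Icc s t, lab x = lab t) :
    (S.labelSlicing lab).map t = (S.labelSlicing lab).map s + (t - s) := by
  have hls : lab s = lab t := h s ⟨le_rfl, hst⟩
  have hset : {x ∈ Set.Ioc (0 : ℝ) 1 | lab x < lab t ∨ lab x = lab t ∧ x ≤ t} =
      {x ∈ Set.Ioc (0 : ℝ) 1 | lab x < lab s ∨ lab x = lab s ∧ x ≤ s} ∪ Set.Ioc s t := by
    ext x
    simp only [Set.mem_union, Set.mem_ofPred_eq, hls]
    constructor
    · rintro ⟨hx, h1 | ⟨h1, h2⟩⟩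
      · exact Or.inl ⟨hx, Or.inl h1⟩
      · rcases le_or_gt x s with h3 | h3
        · exact Or.inl ⟨hx, Or.inr ⟨h1, h3⟩⟩
        · exact Or.inr ⟨h3, h2⟩
    · rintro (⟨hx, h1 | ⟨h1, h2⟩⟩ | hx)
      · exact ⟨hx, Or.inl h1⟩
      · exact ⟨hx, Or.inr ⟨h1, h2.trans hst⟩⟩
      · exact ⟨⟨hs.1.trans hx.1, hx.2.trans ht.2⟩, Or.inr ⟨h x ⟨hx.1.le, hx.2⟩, hx.2⟩⟩
  have hdisj : Disjoint {x ∈ Set.Ioc (0 : ℝ) 1 | lab x < lab s ∨ lab x = lab s ∧ x ≤ s}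
      (Set.Ioc s t) := by
    refine Set.disjoint_left.2 fun x hx hxt => ?_
    have hxl : lab x = lab s := (h x ⟨hxt.1.le, hxt.2⟩).trans hls.symm
    rcases hx.2 with h1 | h1
    · exact absurd hxl h1.ne
    · exact absurd h1.2 (not_le.2 hxt.1)
  rw [S.labelSlicing_map hlab ht, S.labelSlicing_map hlab hs, hset,
    measureReal_union hdisj measurableSet_Ioc
      (volume_ne_top_of_subset_Ioc fun x hx => hx.1) (by simp),
    Real.volume_real_Ioc_of_le hst]

/-- A convex union of slices is a half-open interval. -/
lemma exists_eq_Ioc {T : Set ℝ} (hT : T ⊆ Set.Ioc 0 1)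
    (hsat : ∀ i, ∀ x ∈ S.slice i, (x ∈ T ↔ S.cut i.succ ∈ T))
    (hconv : ∀ x ∈ T, ∀ z ∈ T, ∀ y, x < y → y < z → y ∈ T) :
    ∃ p r, T = Set.Ioc p r := by
  classical
  set I : Finset (Fin n) := Finset.univ.filter fun i => S.cut i.succ ∈ T with hI
  have hmemI : ∀ i, i ∈ I ↔ S.cut i.succ ∈ T := by simp [hI]
  rcases I.eq_empty_or_nonempty with h0 | hne
  · refine ⟨0, 0, ?_⟩
    rw [Set.Ioc_self, Set.eq_empty_iff_forall_notMem]
    intro x hx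
    obtain ⟨i, hi⟩ := S.exists_mem_slice (hT hx)
    have : i ∈ I := (hmemI i).2 ((hsat i x hi).1 hx)
    simp [h0] at this
  · have hp := (hmemI _).1 (I.min'_mem hne)
    have hr := (hmemI _).1 (I.max'_mem hne)
    refine ⟨S.cut (I.min' hne).castSucc, S.cut (I.max' hne).succ, Set.Subset.antisymm ?_ ?_⟩
    · intro x hx
      obtain ⟨i, hi⟩ := S.exists_mem_slice (hT hx)
      have hiI : i ∈ I := (hmemI i).2 ((hsat i x hi).1 hx)
      refine ⟨lt_of_le_of_lt (S.strictMono.monotone ?_) hi.1,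
        hi.2.trans (S.strictMono.monotone ?_)⟩
      · exact Fin.castSucc_le_castSucc_iff.2 (I.min'_le i hiI)
      · exact Fin.succ_le_succ_iff.2 (I.le_max' i hiI)
    · intro x hx
      rcases le_or_gt x (S.cut (I.min' hne).succ) with h | h
      · exact (hsat _ x ⟨hx.1, h⟩).2 hp
      · rcases hx.2.lt_or_eq with h' | h'
        · exact hconv _ hp _ hr x h h'
        · exact h' ▸ hr

variable {d : ℕ}

/-- The straight shuffle of min that sorts the slices in each coordinate by the label functions. -/
noncomputable def shuffle {m : ℕ} (lab : Fin d → ℝ → Fin m) (u : Fin d → unitInterval) :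
    unitInterval :=
  ⟨volume.real {t | t ∈ Set.Ioc (0 : ℝ) 1 ∧
      ∀ k, (S.labelSlicing (lab k)).map t ∈ Set.Ioc 0 (u k : ℝ)}, measureReal_nonneg, by
    refine (measureReal_mono (fun t ht => ht.1) (by simp)).trans_eq
      (b := volume.real (Set.Ioc (0 : ℝ) 1)) ?_
    rw [Real.volume_real_Ioc_of_le zero_le_one, sub_zero]⟩

lemma isShuffleOfMinBy_shuffle {m : ℕ} (lab : Fin d → ℝ → Fin m) :
    IsShuffleOfMinBy (fun k => S.labelSlicing (lab k)) (S.shuffle lab) := fun _ => rfl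

/-- The mass carried by `(0, w]` stays inside the box below `u`. -/
lemma le_shuffle {m : ℕ} {lab : Fin d → ℝ → Fin m} (hlab : ∀ k, S.Adapted (lab k))
    {u : Fin d → unitInterval} {w : ℝ} (hw0 : 0 ≤ w) (hw1 : w ≤ 1)
    (h : ∀ t ∈ Set.Ioc 0 w, ∀ k,
      volume.real {x ∈ Set.Ioc (0 : ℝ) 1 | lab k x ≤ lab k t} ≤ u k) :
    w ≤ S.shuffle lab u := by
  have hw : volume.real (Set.Ioc 0 w) = w := by
    rw [Real.volume_real_Ioc_of_le hw0, sub_zero]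
  refine hw.symm.trans_le (measureReal_mono (fun t ht => ?_)
    (volume_ne_top_of_subset_Ioc fun x hx => hx.1))
  have ht1 : t ∈ Set.Ioc (0 : ℝ) 1 := ⟨ht.1, ht.2.trans hw1⟩
  exact ⟨ht1, fun k => ⟨S.labelSlicing_map_pos (hlab k) ht1,
    (S.labelSlicing_map_le (hlab k) ht1 (P := fun l => l ≤ lab k t) fun l hl => hl).trans
      (h t ht k)⟩⟩

/-- Each point beyond `w` leaves the box below `u` through one of the coordinates. -/
lemma shuffle_le {m : ℕ} {lab : Fin d → ℝ → Fin m} (hlab : ∀ k, S.Adapted (lab k))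
    {u : Fin d → unitInterval} {w : ℝ} (hw0 : 0 ≤ w)
    (h : ∀ t ∈ Set.Ioc w 1, ∃ k,
      u k ≤ volume.real {x ∈ Set.Ioc (0 : ℝ) 1 | lab k x < lab k t}) :
    S.shuffle lab u ≤ w := by
  have hw : volume.real (Set.Ioc 0 w) = w := by
    rw [Real.volume_real_Ioc_of_le hw0, sub_zero]
  refine le_trans (measureReal_mono (fun t ht => ?_) (by simp)) hw.le
  refine ⟨ht.1.1, not_lt.1 fun hwt => ?_⟩
  obtain ⟨k, hk⟩ := h t ⟨hwt, ht.1.2⟩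
  exact absurd ((S.lt_labelSlicing_map (hlab k) ht.1 (P := fun l => l < lab k t)
    fun l hl => hl).trans_le ((ht.2 k).2.trans hk)) (lt_irrefl _)

end Subdivision

/-! ### The 3-slice property. -/

lemma exists_Ioc_eq_forall_mem_Ioc {ι : Type*} (s : Finset ι) (p r : ℝ) (A B : ι → ℝ) :
    ∃ p' r', {t | t ∈ Set.Ioc p r ∧ ∀ k ∈ s, t ∈ Set.Ioc (A k) (B k)} = Set.Ioc p' r' := by
  classical
  induction s using Finset.induction with
  | empty => exact ⟨p, r, by ext; simp⟩
  | insert a s _ ih =>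
    obtain ⟨p', r', h⟩ := ih
    refine ⟨max p' (A a), min r' (B a), ?_⟩
    rw [← Set.Ioc_inter_Ioc, ← h]
    ext t
    simp only [Finset.forall_mem_insert, Set.mem_ofPred_eq, Set.mem_inter_iff]
    tauto

/-- Two possibly degenerate cuts of `[0,1]` can be refined to two nondegenerate ones. -/
lemma exists_refined_cuts {x y : ℝ} (hx : 0 ≤ x) (hxy : x ≤ y) (hy : y ≤ 1) :
    ∃ c : Fin 4 → ℝ, StrictMono c ∧ c 0 = 0 ∧ c (Fin.last 3) = 1 ∧
      ∀ i : Fin 3, c i.succ ≤ x ∨ (x ≤ c i.castSucc ∧ c i.succ ≤ y) ∨ y ≤ c i.castSucc := by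
  -- Cuts equal to 0 or 1 or to each other are replaced by arbitrary additional interior cuts, which
  -- only split the intervals further.
  have key : ∃ x' y' : ℝ, 0 < x' ∧ x' < y' ∧ y' < 1 ∧
      (x = 0 ∨ x = x' ∨ x = y' ∨ x = 1) ∧ (y = 0 ∨ y = x' ∨ y = y' ∨ y = 1) := by
    rcases hx.eq_or_lt with rfl | hx0
    · rcases hxy.eq_or_lt with rfl | hy0
      · exact ⟨1/3, 1/2, by norm_num, by norm_num, by norm_num, by simp, by simp⟩
      · rcases hy.eq_or_lt with rfl | hy1
        · exact ⟨1/3, 1/2, by norm_num, by norm_num, by norm_num, by simp, by simp⟩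
        · exact ⟨y/2, y, by linarith, by linarith, hy1, by simp, by simp⟩
    · rcases hy.eq_or_lt with rfl | hy1
      · rcases hxy.eq_or_lt with rfl | hx1
        · exact ⟨1/3, 1/2, by norm_num, by norm_num, by norm_num, by simp, by simp⟩
        · exact ⟨x, (x+1)/2, by linarith, by linarith, by linarith, by simp, by simp⟩
      · rcases hxy.eq_or_lt with rfl | hxy'
        · exact ⟨x/2, x, by linarith, by linarith, hy1, by simp, by simp⟩
        · exact ⟨x, y, hx0, hxy', hy1, by simp, by simp⟩
  obtain ⟨x', y', h1, h2, h3, h4, h5⟩ := key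
  refine ⟨![0, x', y', 1], ?_, rfl, rfl, ?_⟩
  · rw [Fin.strictMono_iff_lt_succ]
    intro i
    fin_cases i <;> simpa
  · intro i
    fin_cases i <;> simp <;>
      rcases h4 with rfl | rfl | rfl | rfl <;> rcases h5 with rfl | rfl | rfl | rfl <;>
      grind

/-- Cutting coordinate `k` at the masses of the labels below 1 and below 2 makes every box determine
the label in each coordinate. The points with these labels form an interval on which all maps are
translations, and a box cuts a subinterval out of it. -/
lemma Subdivision.isSliceShuffleOfMin_shuffle {n d : ℕ} (S : Subdivision n)
    {lab : Fin d → ℝ → Fin 3} (hlab : ∀ k, S.Adapted (lab k))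
    (hconv : ∀ x ∈ Set.Ioc (0 : ℝ) 1, ∀ z ∈ Set.Ioc (0 : ℝ) 1, ∀ y, x < y → y < z →
      (∀ k, lab k x = lab k z) → ∀ k, lab k y = lab k x) :
    IsSliceShuffleOfMin 3 (S.shuffle lab) := by
  refine ⟨_, S.isShuffleOfMinBy_shuffle lab, ?_⟩
  set W : Fin d → Fin 3 → ℝ := fun k l => volume.real {x ∈ Set.Ioc (0 : ℝ) 1 | lab k x < l}
  have hW1 : ∀ k l, W k l ≤ 1 := fun k l => by
    refine (measureReal_mono (fun t ht => ht.1) (by simp)).trans_eq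
      (b := volume.real (Set.Ioc (0 : ℝ) 1)) ?_
    rw [Real.volume_real_Ioc_of_le zero_le_one, sub_zero]
  have hW12 : ∀ k, W k 1 ≤ W k 2 := fun k =>
    measureReal_mono (fun t ht => ⟨ht.1, ht.2.trans (by decide)⟩)
      (volume_ne_top_of_subset_Ioc fun x hx => hx.1)
  choose c hcm hc0 hc1 hcW using fun k =>
    exists_refined_cuts (x := W k 1) (y := W k 2) measureReal_nonneg (hW12 k) (hW1 k 2)
  refine ⟨c, fun k => ⟨hcm k, hc0 k, hc1 k⟩, fun i => ?_⟩
  -- After sorting, the points with label `g` lie between consecutive values of `W k`, and the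
  -- refined slice lies in one of these three ranges.
  have hg : ∀ k, ∃ g : Fin 3, ∀ t ∈ Set.Ioc (0 : ℝ) 1,
      (S.labelSlicing (lab k)).map t ∈ Set.Ioc (c k (i k).castSucc) (c k (i k).succ) →
        lab k t = g := by
    intro k
    have up : ∀ t ∈ Set.Ioc (0 : ℝ) 1, ∀ l, lab k t < l →
        (S.labelSlicing (lab k)).map t ≤ W k l := fun t ht l hl =>
      S.labelSlicing_map_le (hlab k) ht (P := fun a => a < l) fun a ha => ha.trans_lt hl
    have low : ∀ t ∈ Set.Ioc (0 : ℝ) 1, ∀ l, l ≤ lab k t →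
        W k l < (S.labelSlicing (lab k)).map t := fun t ht l hl =>
      S.lt_labelSlicing_map (hlab k) ht (P := fun a => a < l) fun a ha => ha.trans_le hl
    rcases hcW k (i k) with h | ⟨h, h'⟩ | h
    · refine ⟨0, fun t ht hm => ?_⟩
      by_contra hne
      have := low t ht 1 (by generalize lab k t = a at hne; revert hne; revert a; decide)
      linarith [hm.2]
    · refine ⟨1, fun t ht hm => ?_⟩
      by_contra hne
      rcases lt_or_gt_of_ne hne with hlt | hgt
      · linarith [up t ht 1 hlt, hm.1]
      · have := low t ht 2 (by generalize lab k t = a at hgt; revert hgt; revert a; decide)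
        linarith [hm.2]
    · refine ⟨2, fun t ht hm => ?_⟩
      by_contra hne
      have := up t ht 2 (by generalize lab k t = a at hne; revert hne; revert a; decide)
      linarith [hm.1]
  choose g hg using hg
  set T : Set ℝ := {t | t ∈ Set.Ioc (0 : ℝ) 1 ∧ ∀ k, lab k t = g k} with hT
  have hTconv : ∀ x ∈ T, ∀ z ∈ T, ∀ y, x < y → y < z → y ∈ T := by
    intro x hx z hz y hxy hyz
    refine ⟨⟨hx.1.1.trans hxy, hyz.le.trans hz.1.2⟩, fun k => ?_⟩
    rw [hconv x hx.1 z hz.1 y hxy hyz (fun k => (hx.2 k).trans (hz.2 k).symm) k, hx.2 k]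
  obtain ⟨p, r, hpr⟩ := S.exists_eq_Ioc (T := T) (fun t ht => ht.1) (fun j x hx => by
    have h1 := S.slice_subset j hx
    have h2 := S.slice_subset j (S.cut_succ_mem j)
    simp only [hT, Set.mem_ofPred_eq, h1, h2, true_and]
    exact forall_congr' fun k => by rw [hlab k j x hx]) hTconv
  rcases lt_or_ge p r with hlt | hge
  · have hr : r ∈ T := hpr ▸ ⟨hlt, le_rfl⟩
    -- The translation vector is read off at the right end, which belongs to the interval.
    set v : Fin d → ℝ := fun k => (S.labelSlicing (lab k)).map r - r with hv
    have hmap : ∀ t ∈ T, ∀ k, (S.labelSlicing (lab k)).map t = t + v k := by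
      intro t ht k
      have htr : t ≤ r := (hpr ▸ ht : t ∈ Set.Ioc p r).2
      have := S.labelSlicing_map_sub (hlab k) ht.1 hr.1 htr (fun x hx => by
        have : x ∈ T := hpr ▸ ⟨((hpr ▸ ht : t ∈ Set.Ioc p r).1).trans_le hx.1, hx.2⟩
        rw [this.2 k, hr.2 k])
      rw [hv]; linarith
    obtain ⟨p', r', h'⟩ := exists_Ioc_eq_forall_mem_Ioc Finset.univ p r
      (fun k => c k (i k).castSucc - v k) (fun k => c k (i k).succ - v k)
    refine ⟨p', r', v, ?_, ?_⟩
    · rw [← h', ← hpr]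
      ext t
      simp only [Set.mem_ofPred_eq, Finset.mem_univ, true_imp_iff]
      constructor
      · rintro ⟨ht, hm⟩
        have htT : t ∈ T := ⟨ht, fun k => hg k t ht (hm k)⟩
        refine ⟨htT, fun k => ?_⟩
        have := hm k
        rw [hmap t htT k] at this
        exact ⟨by linarith [this.1], by linarith [this.2]⟩
      · rintro ⟨htT, hm⟩
        refine ⟨htT.1, fun k => ?_⟩
        rw [hmap t htT k]
        exact ⟨by linarith [(hm k).1], by linarith [(hm k).2]⟩
    · intro t ht k
      rw [← h', ← hpr] at ht
      exact hmap t ht.1 k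
  · refine ⟨0, 0, 0, ?_, by simp⟩
    rw [Set.Ioc_self, Set.eq_empty_iff_forall_notMem]
    rintro t ⟨ht, hm⟩
    have htT : t ∈ T := ⟨ht, fun k => hg k t ht (hm k)⟩
    rw [hpr, Set.Ioc_eq_empty (not_lt.2 hge)] at htT
    exact htT

/-- There is a subdivision of `[0,1]` whose slices lie on one side of each of finitely many given
points. -/
lemma exists_subdivision (F : Finset ℝ) : ∃ (n : ℕ) (S : Subdivision n),
    ∀ i, ∀ x ∈ S.slice i, ∀ f ∈ F, (x ≤ f ↔ S.cut i.succ ≤ f) := by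
  classical
  -- Points outside `(0,1)` separate no two points of `(0,1]`, so they need no cut.
  set G : Finset ℝ := insert 0 (insert 1 (F.filter fun f => 0 < f ∧ f < 1)) with hG
  have h0 : (0 : ℝ) ∈ G := by simp [hG]
  have h1 : (1 : ℝ) ∈ G := by simp [hG]
  have hGb : ∀ f ∈ G, 0 ≤ f ∧ f ≤ 1 := by
    intro f hf
    simp only [hG, Finset.mem_insert, Finset.mem_filter] at hf
    rcases hf with rfl | rfl | ⟨-, h, h'⟩
    · simp
    · simp
    · exact ⟨h.le, h'.le⟩
  obtain ⟨n, hn⟩ : ∃ n, G.card = n + 1 :=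
    Nat.exists_eq_succ_of_ne_zero (Finset.card_ne_zero_of_mem h0)
  have hrange : ∀ f ∈ G, ∃ j, G.orderEmbOfFin hn j = f := fun f hf => by
    have : f ∈ Set.range (G.orderEmbOfFin hn) := by
      rw [Finset.range_orderEmbOfFin]; exact hf
    exact this
  have hmem : ∀ j, G.orderEmbOfFin hn j ∈ G := fun j => G.orderEmbOfFin_mem hn j
  have hmono : StrictMono (G.orderEmbOfFin hn) := (G.orderEmbOfFin hn).strictMono
  refine ⟨n, ⟨G.orderEmbOfFin hn, hmono, ?_, ?_⟩, ?_⟩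
  · obtain ⟨j, hj⟩ := hrange 0 h0
    exact le_antisymm (hj ▸ hmono.monotone (Fin.zero_le j)) (hGb _ (hmem 0)).1
  · obtain ⟨j, hj⟩ := hrange 1 h1
    exact le_antisymm (hGb _ (hmem _)).2 (hj ▸ hmono.monotone (Fin.le_last j))
  · intro i x hx f hf
    refine ⟨fun hxf => ?_, fun h => hx.2.trans h⟩
    rcases le_or_gt 1 f with hf1 | hf1
    · exact (hGb _ (hmem _)).2.trans hf1
    · have hf0 : 0 < f := ((hGb _ (hmem i.castSucc)).1.trans_lt hx.1).trans_le hxf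
      obtain ⟨j, hj⟩ := hrange f (by simp [hG, hf, hf0, hf1])
      rw [← hj] at hxf ⊢
      have hij : i.castSucc < j := hmono.lt_iff_lt.1 (hx.1.trans_le hxf)
      exact hmono.monotone (Fin.castSucc_lt_iff_succ_le.1 hij)

/-! ### Three-valued labels given by intervals. -/

open Classical in
/-- The label `2` on `M`, the label `1` on the rest of `N`, and the label `0` elsewhere. -/
noncomputable def levelLabel (M N : Set ℝ) (t : ℝ) : Fin 3 :=
  if t ∈ M then 2 else if t ∈ N then 1 else 0

lemma levelLabel_of_mem {M N : Set ℝ} {t : ℝ} (h : t ∈ M) : levelLabel M N t = 2 := if_pos h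

lemma levelLabel_of_mem_right {M N : Set ℝ} {t : ℝ} (h : t ∉ M) (h' : t ∈ N) :
    levelLabel M N t = 1 := by rw [levelLabel, if_neg h, if_pos h']

lemma levelLabel_of_notMem {M N : Set ℝ} {t : ℝ} (h : t ∉ M) (h' : t ∉ N) :
    levelLabel M N t = 0 := by rw [levelLabel, if_neg h, if_neg h']

lemma levelLabel_eq_two_iff {M N : Set ℝ} {t : ℝ} : levelLabel M N t = 2 ↔ t ∈ M := by
  unfold levelLabel; split_ifs <;> simp_all

lemma levelLabel_congr {M N : Set ℝ} {s t : ℝ} (h : s ∈ M ↔ t ∈ M) (h' : s ∈ N ↔ t ∈ N) :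
    levelLabel M N s = levelLabel M N t := by
  unfold levelLabel; split_ifs <;> tauto

lemma levelLabel_lt_two_iff {M N : Set ℝ} {t : ℝ} : levelLabel M N t < 2 ↔ t ∉ M := by
  unfold levelLabel; split_ifs <;> simp_all

lemma levelLabel_lt_one_iff {M N : Set ℝ} {t : ℝ} : levelLabel M N t < 1 ↔ t ∉ M ∧ t ∉ N := by
  unfold levelLabel; split_ifs <;> simp_all

lemma volume_levelLabel_lt_two {s e : ℝ} (N : Set ℝ) (hs : 0 ≤ s) (hse : s ≤ e) (he : e ≤ 1) :
    volume.real {x ∈ Set.Ioc (0 : ℝ) 1 | levelLabel (Set.Ioc s e) N x < 2} = 1 - (e - s) := by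
  have : {x ∈ Set.Ioc (0 : ℝ) 1 | levelLabel (Set.Ioc s e) N x < 2} =
      Set.Ioc 0 1 \ Set.Ioc s e := by
    ext x; simp only [levelLabel_lt_two_iff]; rfl
  rw [this, measureReal_sdiff (Set.Ioc_subset_Ioc hs he) measurableSet_Ioc (by simp),
    Real.volume_real_Ioc_of_le hse, Real.volume_real_Ioc_of_le zero_le_one, sub_zero]

/-- Only an inequality, since `(l, r]` is not assumed to be disjoint from `(s, e]`. -/
lemma le_volume_levelLabel_lt_one {s e l r : ℝ} (hs : 0 ≤ s) (hse : s ≤ e) (he : e ≤ 1)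
    (hlr : l ≤ r) :
    1 - (e - s) - (r - l) ≤ volume.real
      {x ∈ Set.Ioc (0 : ℝ) 1 | levelLabel (Set.Ioc s e) (Set.Ioc l r) x < 1} := by
  have h1 := volume_levelLabel_lt_two (Set.Ioc l r) hs hse he
  have h2 : volume.real {x ∈ Set.Ioc (0 : ℝ) 1 | levelLabel (Set.Ioc s e) (Set.Ioc l r) x < 2} ≤
      volume.real ({x ∈ Set.Ioc (0 : ℝ) 1 | levelLabel (Set.Ioc s e) (Set.Ioc l r) x < 1} ∪
        Set.Ioc l r) := by
    refine measureReal_mono (fun x hx => ?_) ?_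
    · by_cases h : x ∈ Set.Ioc l r
      · exact Or.inr h
      · exact Or.inl ⟨hx.1, levelLabel_lt_one_iff.2 ⟨levelLabel_lt_two_iff.1 hx.2, h⟩⟩
    · exact measure_union_ne_top
        (Subdivision.volume_ne_top_of_subset_Ioc fun x hx => hx.1) (by simp)
  have h3 := measureReal_union_le (μ := volume)
    {x ∈ Set.Ioc (0 : ℝ) 1 | levelLabel (Set.Ioc s e) (Set.Ioc l r) x < 1} (Set.Ioc l r)
  rw [Real.volume_real_Ioc_of_le hlr] at h3
  linarith

/-- Label functions built from half-open intervals give `3`-slice shuffles of min, provided that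
the points with the same labels in all coordinates form an interval. -/
lemma exists_sliceShuffle_of_levelLabel {d : ℕ} (s e l r : Fin d → ℝ)
    (hconv : ∀ x ∈ Set.Ioc (0 : ℝ) 1, ∀ z ∈ Set.Ioc (0 : ℝ) 1, ∀ y, x < y → y < z →
      (∀ k, levelLabel (Set.Ioc (s k) (e k)) (Set.Ioc (l k) (r k)) x =
        levelLabel (Set.Ioc (s k) (e k)) (Set.Ioc (l k) (r k)) z) →
      ∀ k, levelLabel (Set.Ioc (s k) (e k)) (Set.Ioc (l k) (r k)) y =
        levelLabel (Set.Ioc (s k) (e k)) (Set.Ioc (l k) (r k)) x)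
    (a b : Fin d → unitInterval) {α β : ℝ} (hα0 : 0 ≤ α) (hα1 : α ≤ 1) (hβ0 : 0 ≤ β)
    (ha : ∀ t ∈ Set.Ioc 0 α, ∀ k, volume.real {x ∈ Set.Ioc (0 : ℝ) 1 |
      levelLabel (Set.Ioc (s k) (e k)) (Set.Ioc (l k) (r k)) x ≤
        levelLabel (Set.Ioc (s k) (e k)) (Set.Ioc (l k) (r k)) t} ≤ a k)
    (hb : ∀ t ∈ Set.Ioc β 1, ∃ k, b k ≤ volume.real {x ∈ Set.Ioc (0 : ℝ) 1 |
      levelLabel (Set.Ioc (s k) (e k)) (Set.Ioc (l k) (r k)) x <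
        levelLabel (Set.Ioc (s k) (e k)) (Set.Ioc (l k) (r k)) t}) :
    ∃ C, IsSliceShuffleOfMin 3 C ∧ α ≤ C a ∧ C b ≤ β := by
  classical
  obtain ⟨n, S, hS⟩ := exists_subdivision
    (Finset.univ.image s ∪ Finset.univ.image e ∪ Finset.univ.image l ∪ Finset.univ.image r)
  have hlab : ∀ k, S.Adapted (levelLabel (Set.Ioc (s k) (e k)) (Set.Ioc (l k) (r k))) := by
    intro k i x hx
    have h1 := hS i x hx (s k) (by simp)
    have h2 := hS i x hx (e k) (by simp)
    have h3 := hS i x hx (l k) (by simp)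
    have h4 := hS i x hx (r k) (by simp)
    refine levelLabel_congr ?_ ?_ <;> simp only [Set.mem_Ioc, ← not_le, h1, h2, h3, h4]
  exact ⟨_, S.isSliceShuffleOfMin_shuffle hlab hconv, S.le_shuffle hlab hα0 hα1 ha,
    S.shuffle_le hlab hβ0 hb⟩

/-! ### Laying out intervals of prescribed lengths. -/

/-- The sum of the first `n` entries of a vector. -/
def partialSum {d : ℕ} (v : Fin d → ℝ) (n : ℕ) : ℝ :=
  ∑ i ∈ Finset.range n, if h : i < d then v ⟨i, h⟩ else 0

section partialSum

variable {d : ℕ} {v : Fin d → ℝ}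

lemma partialSum_zero : partialSum v 0 = 0 := by simp [partialSum]

lemma partialSum_succ (k : Fin d) : partialSum v (k + 1) = partialSum v k + v k := by
  simp [partialSum, Finset.sum_range_succ]

lemma partialSum_eq_sum : partialSum v d = ∑ k, v k := by
  simp [partialSum, ← Fin.sum_univ_eq_sum_range]

lemma partialSum_monotone (hv : ∀ k, 0 ≤ v k) : Monotone (partialSum v) := by
  refine monotone_nat_of_le_succ fun n => ?_
  rw [partialSum, partialSum, Finset.sum_range_succ]
  refine le_add_of_nonneg_right ?_
  split_ifs
  · exact hv _
  · exact le_rfl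

lemma partialSum_nonneg (hv : ∀ k, 0 ≤ v k) (n : ℕ) : 0 ≤ partialSum v n :=
  partialSum_zero (v := v) ▸ partialSum_monotone hv (Nat.zero_le n)

lemma exists_partialSum_lt_le {τ : ℝ} (h0 : 0 < τ) (h1 : τ ≤ ∑ k, v k) :
    ∃ k : Fin d, partialSum v k < τ ∧ τ ≤ partialSum v (k + 1) := by
  classical
  have hex : ∃ n, τ ≤ partialSum v n := ⟨d, partialSum_eq_sum (v := v) ▸ h1⟩
  have hle : Nat.find hex ≤ d := Nat.find_min' hex (partialSum_eq_sum (v := v) ▸ h1)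
  obtain ⟨m, hm⟩ : ∃ m, Nat.find hex = m + 1 := by
    refine Nat.exists_eq_succ_of_ne_zero fun h => ?_
    have := Nat.find_spec hex
    rw [h, partialSum_zero] at this
    linarith
  refine ⟨⟨m, by omega⟩, ?_, ?_⟩
  · exact not_le.1 (Nat.find_min hex (m := m) (by omega))
  · have := Nat.find_spec hex
    rwa [hm] at this

/-- Consecutive disjoint intervals of prescribed maximal lengths that cover `(p, q]`. -/
lemma exists_Ioc_partition {p q : ℝ} (hpq : p ≤ q) (hv : ∀ k, 0 ≤ v k) (hsum : q - p ≤ ∑ k, v k) :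
    ∃ l r : Fin d → ℝ, (∀ k, p ≤ l k ∧ l k ≤ r k ∧ r k ≤ q ∧ r k - l k ≤ v k) ∧
      (∀ t ∈ Set.Ioc p q, ∃ k, t ∈ Set.Ioc (l k) (r k)) ∧
      ∀ t i j, t ∈ Set.Ioc (l i) (r i) → t ∈ Set.Ioc (l j) (r j) → i = j := by
  -- The intervals lie end to end, truncated at `q`; those that would start beyond `q` become empty.
  refine ⟨fun k => p + min (partialSum v k) (q - p),
    fun k => p + min (partialSum v (k + 1)) (q - p), fun k => ?_, fun t ht => ?_, ?_⟩
  · have h0 := partialSum_nonneg hv k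
    have h1 := partialSum_succ (v := v) k
    have h2 := hv k
    refine ⟨?_, ?_, ?_, ?_⟩ <;> grind
  · obtain ⟨k, h1, h2⟩ := exists_partialSum_lt_le (sub_pos.2 ht.1)
      ((sub_le_sub_right ht.2 p).trans hsum)
    have := ht.2
    refine ⟨k, ?_, ?_⟩ <;> grind
  · have key : ∀ t (i j : Fin d), i < j → t ≤ p + min (partialSum v (i + 1)) (q - p) →
        ¬ p + min (partialSum v j) (q - p) < t := by
      intro t i j hij h
      have : partialSum v (i + 1) ≤ partialSum v j := partialSum_monotone hv hij
      grind
    intro t i j hi hj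
    rcases lt_trichotomy i j with h | h | h
    · exact absurd hj.1 (key t i j h hi.2)
    · exact h
    · exact absurd hi.1 (key t j i h hj.2)

/-- Intervals of prescribed lengths that cover `(q, 1]` in such a way that the points which belong
to the same intervals form an interval. -/
lemma exists_Ioc_cover {q : ℝ} (hv : ∀ k, 0 ≤ v k) (hvq : ∀ k, v k ≤ 1 - q)
    (hsum : 1 - q ≤ ∑ k, v k) :
    ∃ s e : Fin d → ℝ, (∀ k, q ≤ s k ∧ s k ≤ e k ∧ e k ≤ 1 ∧ e k - s k = v k) ∧
      (∀ t ∈ Set.Ioc q 1, ∃ k, t ∈ Set.Ioc (s k) (e k)) ∧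
      ∀ x ∈ Set.Ioc q 1, ∀ z ∈ Set.Ioc q 1, ∀ y, x < y → y < z →
        (∀ k, x ∈ Set.Ioc (s k) (e k) ↔ z ∈ Set.Ioc (s k) (e k)) →
        ∀ k, y ∈ Set.Ioc (s k) (e k) ↔ x ∈ Set.Ioc (s k) (e k) := by
  -- Here the lengths must be exact: an interval that would end beyond 1 is shifted back to end at
  -- 1, and `v k ≤ 1 - q` keeps its start at or above `q`. Only such shifted intervals can overlap
  -- earlier ones.
  set e : Fin d → ℝ := fun k => q + min (partialSum v (k + 1)) (1 - q) with he
  have hek : ∀ k, e k = q + min (partialSum v (k + 1)) (1 - q) := fun _ => rfl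
  have hcover : ∀ t ∈ Set.Ioc q 1, ∃ k : Fin d, t ∈ Set.Ioc (e k - v k) (e k) ∧
      partialSum v k < t - q := by
    intro t ht
    obtain ⟨k, h1, h2⟩ := exists_partialSum_lt_le (sub_pos.2 ht.1)
      ((sub_le_sub_right ht.2 q).trans hsum)
    have h3 := partialSum_succ (v := v) k
    have := ht.2
    refine ⟨k, ⟨?_, ?_⟩, h1⟩ <;> rw [hek] <;> grind
  refine ⟨fun k => e k - v k, e, fun k => ?_, fun t ht => ?_, ?_⟩
  · have h0 := partialSum_nonneg hv k
    have h1 := partialSum_succ (v := v) k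
    have h2 := hv k
    have h3 := hvq k
    have h4 := hek k
    refine ⟨?_, ?_, ?_, ?_⟩ <;> grind
  · obtain ⟨k, hk, -⟩ := hcover t ht
    exact ⟨k, hk⟩
  · intro x hx z hz y hxy hyz hiff j
    refine ⟨fun hy => ?_, fun hxj => ⟨hxj.1.trans hxy, hyz.le.trans ((hiff j).1 hxj).2⟩⟩
    -- If `y` is in interval `j` but `x` and `z` are not, then `j` ends before `z`, hence was not
    -- shifted. An interval `i` that covers `x` and has an earlier index ends before `y`, so it
    -- cannot contain `z`.
    by_contra hxj
    have hzj : z ∉ Set.Ioc (e j - v j) (e j) := fun h => hxj ((hiff j).2 h)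
    have hxs : x ≤ e j - v j := not_lt.1 fun h => hxj ⟨h, hxy.le.trans hy.2⟩
    have hez : e j < z := not_le.1 fun h => hzj ⟨hy.1.trans hyz, h⟩
    have hej : e j = q + partialSum v (j + 1) := by
      have := hz.2
      have := hek j
      grind
    obtain ⟨i, hi, hit⟩ := hcover x hx
    have hzi := ((hiff i).1 hi).2
    have hsucc := partialSum_succ (v := v) j
    have hij : i < j := by
      by_contra h
      have : partialSum v j ≤ partialSum v i :=
        partialSum_monotone hv (show (j : ℕ) ≤ i from not_lt.1 h)
      linarith
    have h1 : partialSum v (i + 1) ≤ partialSum v j := partialSum_monotone hv hij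
    have h2 : e i ≤ q + partialSum v (i + 1) := by
      rw [hek]; gcongr; exact min_le_left _ _
    linarith [hy.1]

end partialSum

/-! ### The shuffle for two given points. -/

/-- Label 2 marks intervals of length `1 - b k` that cover `(β, 1]`, so their points move above `b
k`. Label 0 marks exactly `(0, α]`, which therefore stays at or below `α ≤ a k`. -/
lemma exists_sliceShuffle_of_le {d : ℕ} (hd : 1 ≤ d) (a b : Fin d → unitInterval) {α β : ℝ}
    (hα0 : 0 ≤ α) (hβ1 : β ≤ 1) (hαβ : α ≤ β) (hαa : ∀ k, α ≤ a k) (hβb : ∀ k, β ≤ b k)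
    (hsum : 1 - β ≤ ∑ k, (1 - (b k : ℝ))) :
    ∃ C, IsSliceShuffleOfMin 3 C ∧ α ≤ C a ∧ C b ≤ β := by
  obtain ⟨s, e, hse, hcover, hconv⟩ := exists_Ioc_cover (v := fun k => 1 - (b k : ℝ)) (q := β)
    (fun k => sub_nonneg.2 (b k).2.2) (fun k => sub_le_sub_left (hβb k) 1) hsum
  have hMN : ∀ t k, t ≤ β → t ∉ Set.Ioc (s k) (e k) := fun t k ht h =>
    absurd (h.1.trans_le ht) (not_lt.2 (hse k).1)
  have hlow : ∀ t k, t ≤ α → levelLabel (Set.Ioc (s k) (e k)) (Set.Ioc α 1) t = 0 := fun t k ht =>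
    levelLabel_of_notMem (hMN t k (ht.trans hαβ)) fun h => absurd h.1 (not_lt.2 ht)
  have hmid : ∀ t k, α < t → t ≤ β → levelLabel (Set.Ioc (s k) (e k)) (Set.Ioc α 1) t = 1 :=
    fun t k h h' => levelLabel_of_mem_right (hMN t k h') ⟨h, h'.trans hβ1⟩
  have hne : ∀ t k, α < t → t ≤ 1 → levelLabel (Set.Ioc (s k) (e k)) (Set.Ioc α 1) t ≠ 0 := by
    intro t k h h'
    by_cases hM : t ∈ Set.Ioc (s k) (e k)
    · rw [levelLabel_of_mem hM]; decide
    · rw [levelLabel_of_mem_right hM (show t ∈ Set.Ioc α 1 from ⟨h, h'⟩)]; decide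
  refine exists_sliceShuffle_of_levelLabel s e (fun _ => α) (fun _ => 1) ?_ a b hα0
    (hαβ.trans hβ1) (hα0.trans hαβ) ?_ ?_
  · intro x hx z hz y hxy hyz hxz k
    rcases le_or_gt x α with hxα | hxα
    · have hzα : z ≤ α := by
        by_contra h
        refine hne z ⟨0, hd⟩ (not_le.1 h) hz.2 ?_
        rw [← hxz, hlow _ _ hxα]
      rw [hlow _ _ hxα, hlow _ _ (hyz.le.trans hzα)]
    · rcases le_or_gt x β with hxβ | hxβ
      · have hzβ : z ≤ β := by
          by_contra h
          obtain ⟨j, hj⟩ := hcover z ⟨not_le.1 h, hz.2⟩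
          have := hxz j
          rw [levelLabel_of_mem hj, hmid x j hxα hxβ] at this
          exact absurd this (by decide)
        rw [hmid _ _ hxα hxβ, hmid _ _ (hxα.trans hxy) (hyz.le.trans hzβ)]
      · refine levelLabel_congr (hconv x ⟨hxβ, hx.2⟩ z ⟨hxβ.trans (hxy.trans hyz), hz.2⟩ y hxy hyz
          (fun j => ?_) k) ?_
        · rw [← levelLabel_eq_two_iff (N := Set.Ioc α 1), hxz j, levelLabel_eq_two_iff]
        · simp only [Set.mem_Ioc, hxα, hx.2, hxα.trans hxy, hyz.le.trans hz.2]
  · intro t ht k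
    rw [hlow t k ht.2]
    refine (measureReal_mono (fun x hx => ?_) (by simp)).trans
      ((Real.volume_real_Ioc_of_le hα0).trans_le ((sub_zero α).trans_le (hαa k)))
    exact ⟨hx.1.1, not_lt.1 fun h => hne x k h hx.1.2 (Fin.le_zero_iff.1 hx.2)⟩
  · intro t ht
    obtain ⟨k, hk⟩ := hcover t ht
    refine ⟨k, ?_⟩
    obtain ⟨h1, h2, h3, h4⟩ := hse k
    rw [levelLabel_of_mem hk, volume_levelLabel_lt_two _ ((hα0.trans hαβ).trans h1) h2 h3, h4]
    linarith

/-- The points of `(β, α]` must stay below `a` in all coordinates, yet exceed `b` in one. This one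
is a coordinate with `b k < a k`, where the point gets label 1 and lands between `b k` and `a k`.
The points beyond `α` exceed `b` by label 2, as in the other case. -/
lemma exists_sliceShuffle_of_lt {d : ℕ} (a b : Fin d → unitInterval) {α β : ℝ}
    (hβ0 : 0 ≤ β) (hα1 : α ≤ 1) (hβα : β < α) (hαa : ∀ k, α ≤ a k)
    (hsum : 1 - β ≤ ∑ k, (1 - (b k : ℝ)))
    (hsum' : α - β ≤ ∑ k, max ((a k : ℝ) - b k) 0) :
    ∃ C, IsSliceShuffleOfMin 3 C ∧ α ≤ C a ∧ C b ≤ β := by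
  classical
  obtain ⟨l, r, hlr, hlcover, hldisj⟩ := exists_Ioc_partition
    (v := fun k => max ((a k : ℝ) - b k) 0) hβα.le (fun k => le_max_right _ _) hsum'
  have hlv : ∀ k, r k - l k ≤ max ((a k : ℝ) - b k) 0 := fun k => (hlr k).2.2.2
  have hlx : ∀ k, r k - l k ≤ 1 - b k := fun k =>
    (hlv k).trans (max_le (sub_le_sub_right (a k).2.2 _) (sub_nonneg.2 (b k).2.2))
  have hxsum : ∑ k, (r k - l k) ≤ α - β := by
    have hreal : volume.real (⋃ k ∈ Finset.univ, Set.Ioc (l k) (r k)) = ∑ k, (r k - l k) := by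
      rw [measureReal_biUnion_finset (fun i _ j _ hij => Set.disjoint_left.2 fun t hi hj =>
        hij (hldisj t i j hi hj)) (fun _ _ => measurableSet_Ioc) (fun _ _ => by simp)]
      exact Finset.sum_congr rfl fun k _ => Real.volume_real_Ioc_of_le (hlr k).2.1
    rw [← hreal, ← Real.volume_real_Ioc_of_le hβα.le]
    exact measureReal_mono (Set.iUnion₂_subset fun k _ =>
      Set.Ioc_subset_Ioc (hlr k).1 (hlr k).2.2.1) (by simp)
  -- The labels 1 and 2 together may take up at most `1 - b k`, so that the points with label 1
  -- still move above `b k`; the bound `1 - α` lets the interval fit into `(α, 1]`. If no length is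
  -- capped by it, the lengths sum to at least `(1 - β) - (α - β)`.
  obtain ⟨s, e, hse, hcover, hconv⟩ := exists_Ioc_cover
    (v := fun k => min (1 - α) (1 - (b k : ℝ) - (r k - l k))) (q := α)
    (fun k => le_min (sub_nonneg.2 hα1) (sub_nonneg.2 (hlx k))) (fun k => min_le_left _ _) (by
      by_cases h : ∃ k, 1 - α ≤ 1 - (b k : ℝ) - (r k - l k)
      · obtain ⟨k, hk⟩ := h
        refine (min_eq_left hk).symm.trans_le (Finset.single_le_sum
          (f := fun k => min (1 - α) (1 - (b k : ℝ) - (r k - l k))) (fun j _ => ?_)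
          (Finset.mem_univ k))
        exact le_min (sub_nonneg.2 hα1) (sub_nonneg.2 (hlx j))
      · push Not at h
        rw [Finset.sum_congr rfl fun k _ => min_eq_right (h k).le, Finset.sum_sub_distrib]
        linarith)
  -- If `a k ≤ b k`, the interval of coordinate `k` in `(β, α]` is empty. Label 1 is then used on
  -- `(α, 1]` instead, which leaves label 0 exactly on `(0, α]`, of mass `α ≤ a k`.
  have hN : ∀ k, ∃ l' r' : ℝ, (b k < a k → l' = l k ∧ r' = r k) ∧
      (a k ≤ b k → l' = α ∧ r' = 1) := by
    intro k
    rcases lt_or_ge (b k) (a k) with h | h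
    · exact ⟨l k, r k, fun _ => ⟨rfl, rfl⟩, fun h' => absurd h (not_lt.2 h')⟩
    · exact ⟨α, 1, fun h' => absurd h (not_le.2 h'), fun _ => ⟨rfl, rfl⟩⟩
  choose l' r' hN1 hN2 using hN
  set lab : Fin d → ℝ → Fin 3 :=
    fun k => levelLabel (Set.Ioc (s k) (e k)) (Set.Ioc (l' k) (r' k))
  have hlabdef : ∀ k, lab k = levelLabel (Set.Ioc (s k) (e k)) (Set.Ioc (l' k) (r' k)) :=
    fun _ => rfl
  have hltab : ∀ k t, t ∈ Set.Ioc (l k) (r k) → b k < a k := by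
    intro k t ht
    by_contra h
    have h1 := hlv k
    have : ((a k : ℝ)) - b k ≤ 0 := sub_nonpos.2 (not_lt.1 h)
    rw [max_eq_right this] at h1
    linarith [ht.1, ht.2]
  have hM : ∀ t k, t ≤ α → t ∉ Set.Ioc (s k) (e k) := fun t k ht h =>
    absurd (h.1.trans_le ht) (not_lt.2 (hse k).1)
  have hcore : ∀ t k, t ≤ α → t ∉ Set.Ioc (l k) (r k) → lab k t = 0 := by
    intro t k ht h
    refine levelLabel_of_notMem (hM t k ht) ?_
    rcases lt_or_ge (b k) (a k) with h' | h'
    · rw [(hN1 k h').1, (hN1 k h').2]; exact h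
    · rw [(hN2 k h').1]; exact fun h'' => absurd h''.1 (not_lt.2 ht)
  have hlow : ∀ t k, t ≤ β → lab k t = 0 := fun t k ht =>
    hcore t k (ht.trans hβα.le) fun h => absurd h.1 (not_lt.2 (ht.trans (hlr k).1))
  have hmid : ∀ t k, t ∈ Set.Ioc (l k) (r k) → lab k t = 1 := by
    intro t k h
    refine levelLabel_of_mem_right (hM t k (h.2.trans (hlr k).2.2.1)) ?_
    rw [(hN1 k (hltab k t h)).1, (hN1 k (hltab k t h)).2]
    exact h
  have hgt : ∀ t k, α < t → t ∉ Set.Ioc (l k) (r k) := fun t k h h' =>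
    absurd (h.trans_le (h'.2.trans (hlr k).2.2.1)) (lt_irrefl _)
  refine exists_sliceShuffle_of_levelLabel s e l' r' ?_ a b (hβ0.trans hβα.le) hα1 hβ0 ?_ ?_
  · intro x hx z hz y hxy hyz hxz k
    change lab k y = lab k x
    have hxz' : ∀ k, lab k x = lab k z := hxz
    rcases le_or_gt x β with hxβ | hxβ
    · have hzβ : z ≤ β := by
        by_contra h
        rcases le_or_gt z α with hzα | hzα
        · obtain ⟨j, hj⟩ := hlcover z ⟨not_le.1 h, hzα⟩
          have := hxz' j
          rw [hlow x j hxβ, hmid z j hj] at this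
          exact absurd this (by decide)
        · obtain ⟨j, hj⟩ := hcover z ⟨hzα, hz.2⟩
          have := hxz' j
          rw [hlow x j hxβ, hlabdef, levelLabel_of_mem hj] at this
          exact absurd this (by decide)
      rw [hlow _ _ hxβ, hlow _ _ (hyz.le.trans hzβ)]
    · rcases le_or_gt x α with hxα | hxα
      -- The coordinate with label 1 identifies the piece of `(β, α]` that contains `x`, so `z` lies
      -- in the same piece, and so does `y`.
      · obtain ⟨j, hj⟩ := hlcover x ⟨hxβ, hxα⟩
        have hzj : z ∈ Set.Ioc (l j) (r j) := by
          have h1 := hxz' j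
          rw [hmid x j hj] at h1
          have hba := hltab j x hj
          by_contra hzl
          by_cases hzM : z ∈ Set.Ioc (s j) (e j)
          · rw [hlabdef, levelLabel_of_mem hzM] at h1
            exact absurd h1 (by decide)
          · rw [hlabdef, levelLabel_of_notMem hzM (by
              rw [(hN1 j hba).1, (hN1 j hba).2]; exact hzl)] at h1
            exact absurd h1 (by decide)
        have hyj : y ∈ Set.Ioc (l j) (r j) := ⟨hj.1.trans hxy, hyz.le.trans hzj.2⟩
        rcases eq_or_ne k j with rfl | hkj
        · rw [hmid y k hyj, hmid x k hj]
        · rw [hcore x k hxα fun h => hkj (hldisj x k j h hj),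
            hcore y k (hyj.2.trans (hlr j).2.2.1) fun h => hkj (hldisj y k j h hyj)]
      · refine levelLabel_congr (hconv x ⟨hxα, hx.2⟩ z ⟨hxα.trans (hxy.trans hyz), hz.2⟩ y hxy hyz
          (fun j => ?_) k) ?_
        · rw [← levelLabel_eq_two_iff (N := Set.Ioc (l' j) (r' j)), hxz j, levelLabel_eq_two_iff]
        · rcases lt_or_ge (b k) (a k) with h' | h'
          · rw [(hN1 k h').1, (hN1 k h').2]
            simp only [hgt x k hxα, hgt y k (hxα.trans hxy)]
          · rw [(hN2 k h').1, (hN2 k h').2]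
            simp only [Set.mem_Ioc, hxα, hx.2, hxα.trans hxy, hyz.le.trans hz.2]
  · intro t ht k
    change volume.real {x ∈ Set.Ioc (0 : ℝ) 1 | lab k x ≤ lab k t} ≤ a k
    obtain ⟨h1, h2, h3, h4⟩ := hse k
    rcases lt_or_ge (b k) (a k) with h' | h'
    · have ht2 : lab k t < 2 := levelLabel_lt_two_iff.2 (hM t k ht.2)
      have hx := hlv k
      rw [max_eq_left (sub_nonneg.2 (show (b k : ℝ) ≤ a k from h'.le))] at hx
      refine (measureReal_mono (s₂ := {x ∈ Set.Ioc (0 : ℝ) 1 | lab k x < 2})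
        (fun x hx => ⟨hx.1, hx.2.trans_lt ht2⟩)
        (Subdivision.volume_ne_top_of_subset_Ioc fun x hx => hx.1)).trans
        ((volume_levelLabel_lt_two _ ((hβ0.trans hβα.le).trans h1) h2 h3).trans_le ?_)
      rw [h4]
      -- Label 2 has mass at least `1 - a k`, so the labels 0 and 1 fit below `a k`.
      have : 1 - (a k : ℝ) ≤ min (1 - α) (1 - (b k : ℝ) - (r k - l k)) :=
        le_min (by linarith [hαa k]) (by linarith)
      linarith
    · rw [hcore t k ht.2 fun h => absurd (hltab k t h) (not_lt.2 h')]
      refine (measureReal_mono (fun x hx => ?_) (by simp)).trans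
        ((Real.volume_real_Ioc_of_le (hβ0.trans hβα.le)).trans_le ((sub_zero α).trans_le (hαa k)))
      refine ⟨hx.1.1, not_lt.1 fun h => ?_⟩
      have h0 : lab k x < 1 := hx.2.trans_lt (by decide)
      refine (levelLabel_lt_one_iff.1 h0).2 ?_
      rw [(hN2 k h').1, (hN2 k h').2]
      exact ⟨h, hx.1.2⟩
  · intro t ht
    rcases le_or_gt t α with htα | htα
    · obtain ⟨k, hk⟩ := hlcover t ⟨ht.1, htα⟩
      refine ⟨k, ?_⟩
      change _ ≤ volume.real {x ∈ Set.Ioc (0 : ℝ) 1 | lab k x < lab k t}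
      obtain ⟨h1, h2, h3, h4⟩ := hse k
      have hba := hltab k t hk
      have := le_volume_levelLabel_lt_one ((hβ0.trans hβα.le).trans h1) h2 h3 (hlr k).2.1
      rw [hmid t k hk, hlabdef]
      rw [(hN1 k hba).1, (hN1 k hba).2]
      refine le_trans ?_ this
      rw [h4]
      linarith [min_le_right (1 - α) (1 - (b k : ℝ) - (r k - l k))]
    · obtain ⟨k, hk⟩ := hcover t ⟨htα, ht.2⟩
      refine ⟨k, ?_⟩
      obtain ⟨h1, h2, h3, h4⟩ := hse k
      rw [levelLabel_of_mem hk,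
        volume_levelLabel_lt_two _ ((hβ0.trans hβα.le).trans h1) h2 h3, h4]
      linarith [min_le_right (1 - α) (1 - (b k : ℝ) - (r k - l k)), (hlr k).2.1]

/-! ### Inequalities for quasi-copulas. -/

namespace IsQuasiCopula

variable {d : ℕ} {Q : (Fin d → unitInterval) → unitInterval}

lemma update_sub_update_le (hQ : IsQuasiCopula Q) (j : Fin d) (u : Fin d → unitInterval)
    (s t : unitInterval) :
    (Q (Function.update u j s) : ℝ) - Q (Function.update u j t) ≤ max ((s : ℝ) - t) 0 := by
  rcases le_total s t with h | h
  · exact le_max_of_le_right (sub_nonpos.2 (hQ.increasing j u s t h))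
  · refine le_max_of_le_left (((le_abs_self _).trans (hQ.lipschitz j u s t)).trans_eq ?_)
    exact abs_of_nonneg (sub_nonneg.2 h)

lemma sub_le_sum (hQ : IsQuasiCopula Q) (a b : Fin d → unitInterval) :
    (Q a : ℝ) - Q b ≤ ∑ k, max ((a k : ℝ) - b k) 0 := by
  classical
  -- The coordinates are changed from `b` to `a` one at a time; a decrease costs nothing by
  -- monotonicity.
  have key : ∀ s : Finset (Fin d),
      (Q (s.piecewise a b) : ℝ) - Q b ≤ ∑ k ∈ s, max ((a k : ℝ) - b k) 0 := by
    intro s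
    induction s using Finset.induction with
    | empty => simp
    | insert j s hj ih =>
      rw [Finset.sum_insert hj, Finset.piecewise_insert]
      have h := hQ.update_sub_update_le j (s.piecewise a b) (a j) (b j)
      have h' : Function.update (s.piecewise a b) j (b j) = s.piecewise a b := by
        rw [Function.update_eq_self_iff, Finset.piecewise_eq_of_notMem _ _ _ hj]
      rw [h'] at h
      linarith
  simpa using key Finset.univ

/-- Raising the other coordinates to 1 does not decrease `Q` and leads to the margin. -/
lemma le_apply (hQ : IsQuasiCopula Q) (u : Fin d → unitInterval) (k : Fin d) :
    (Q u : ℝ) ≤ u k := by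
  have h := hQ.sub_le_sum u (Function.update (fun _ => 1) k (u k))
  rw [hQ.margin, Finset.sum_eq_zero] at h
  · linarith
  · intro j _
    refine max_eq_right ?_
    rcases eq_or_ne j k with rfl | hjk
    · simp
    · rw [Function.update_of_ne hjk]
      exact sub_nonpos.2 (u j).2.2

lemma apply_one (hQ : IsQuasiCopula Q) (hd : 1 ≤ d) : Q (fun _ => 1) = 1 := by
  have h := hQ.margin ⟨0, hd⟩ 1
  rwa [Function.update_eq_self_iff.2 rfl] at h

lemma one_sub_le_sum (hQ : IsQuasiCopula Q) (hd : 1 ≤ d) (u : Fin d → unitInterval) :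
    1 - (Q u : ℝ) ≤ ∑ k, (1 - (u k : ℝ)) := by
  have h := hQ.sub_le_sum (fun _ => 1) u
  rw [hQ.apply_one hd] at h
  refine h.trans_eq (Finset.sum_congr rfl fun k _ => max_eq_left (sub_nonneg.2 (u k).2.2))

/-- For any two points there is a `3`-slice shuffle of min that lies above the quasi-copula at the
first point and below it at the second one. -/
lemma exists_sliceShuffle (hQ : IsQuasiCopula Q) (hd : 1 ≤ d) (a b : Fin d → unitInterval) :
    ∃ C, IsSliceShuffleOfMin 3 C ∧ Q a ≤ C a ∧ C b ≤ Q b := by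
  rcases le_or_gt (Q a : ℝ) (Q b) with h | h
  · exact exists_sliceShuffle_of_le hd a b (Q a).2.1 (Q b).2.2 h (hQ.le_apply a) (hQ.le_apply b)
      (hQ.one_sub_le_sum hd b)
  · exact exists_sliceShuffle_of_lt a b (Q b).2.1 (Q a).2.2 h (hQ.le_apply a)
      (hQ.one_sub_le_sum hd b) (hQ.sub_le_sum a b)

end IsQuasiCopula

/-! ### From two points to lattice representations. -/

section TwoPoints

variable {d : ℕ} {D : Set ((Fin d → unitInterval) → unitInterval)}
  {Q : (Fin d → unitInterval) → unitInterval}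

/-- At `u`, the infimum for `a` is at most `Q u` by its member with `b = u`, and the infimum for `a
= u` attains `Q u`. -/
lemma isSupOfInfs_of_two_points (h : ∀ a b, ∃ C ∈ D, Q a ≤ C a ∧ C b ≤ Q b) :
    IsSupOfInfs D Q := by
  choose C hCD hCa hCb using h
  refine ⟨Set.range fun a u => ⨅ b, C a b u, ?_, Set.range_nonempty _, fun u => ⟨?_, ?_⟩⟩
  · rintro _ ⟨a, rfl⟩
    refine ⟨Set.range (C a), Set.range_subset_iff.2 (hCD a), Set.range_nonempty _, fun u => ?_⟩
    rw [← Set.range_comp]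
    exact isGLB_iInf
  · rintro _ ⟨_, ⟨a, rfl⟩, rfl⟩
    exact (iInf_le _ u).trans (hCb a u)
  · intro v hv
    refine le_trans (le_iInf fun b => ?_) (hv ⟨_, ⟨u, rfl⟩, rfl⟩)
    exact hCa u b

lemma isInfOfSups_of_two_points (h : ∀ a b, ∃ C ∈ D, Q a ≤ C a ∧ C b ≤ Q b) :
    IsInfOfSups D Q := by
  choose C hCD hCa hCb using h
  refine ⟨Set.range fun b u => ⨆ a, C a b u, ?_, Set.range_nonempty _, fun u => ⟨?_, ?_⟩⟩
  · rintro _ ⟨b, rfl⟩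
    refine ⟨Set.range fun a => C a b, Set.range_subset_iff.2 fun a => hCD a b,
      Set.range_nonempty _, fun u => ?_⟩
    rw [← Set.range_comp]
    exact isLUB_iSup
  · rintro _ ⟨_, ⟨b, rfl⟩, rfl⟩
    exact (hCa u b).trans (le_iSup (fun a => C a b u) u)
  · intro v hv
    refine (hv ⟨_, ⟨u, rfl⟩, rfl⟩).trans (iSup_le fun a => ?_)
    exact hCb a u

end TwoPoints

theorem mainTheorem2 (d : ℕ) (hd : 1 ≤ d) (Q : (Fin d → unitInterval) → unitInterval)
    (hQ : IsQuasiCopula Q) :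
    (IsSupOfInfs {C | IsStraightShuffleOfMin C} Q ∧
      IsInfOfSups {C | IsStraightShuffleOfMin C} Q) ∧
    (IsSupOfInfs {C | IsSliceShuffleOfMin 3 C} Q ∧
      IsInfOfSups {C | IsSliceShuffleOfMin 3 C} Q) := by
  have h3 := hQ.exists_sliceShuffle hd
  have h : ∀ a b, ∃ C ∈ {C | IsStraightShuffleOfMin C}, Q a ≤ C a ∧ C b ≤ Q b := fun a b => by
    obtain ⟨C, ⟨σ, hσ, -⟩, hC⟩ := h3 a b
    exact ⟨C, ⟨σ, hσ⟩, hC⟩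
  exact ⟨⟨isSupOfInfs_of_two_points h, isInfOfSups_of_two_points h⟩,
    isSupOfInfs_of_two_points h3, isInfOfSups_of_two_points h3⟩
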